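/- **Lemma 4.1.** A norm $\|\cdot\|$ on $\mathbb{R}^{p\times m}$ is called unitarily invariant if $\|UAV\|=\|A\|$ for all $A\in\mathbb{R}^{p\times m}$ and all orthogonal matrices $U\in O(p)$, $V\in O(m)$. For a matrix $A\in\mathbb{R}^{a\times b}$ of a smaller size, $a\le p$ and $b\le m$, write $\|A\|$ for the norm of the $p\times m$ matrix $\begin{pmatrix}A&0\\0&0\end{pmatrix}$. Let $\|\cdot\|_F$ denote the Frobenius norm. There exists an absolute constant $c_0\in(0,1)$ such that the following holds. Let $k\ge 50$ and $s\ge 1$ be integers. For every matrix $D\in\mathbb{R}^{k\times s}$ there exists a matrix $W\in\mathbb{R}^{k\times s}$ such that $$\|W\|_F\le\|D\|_F$$ and such that, for every set $B\subset\{1,\dots,k\}$ with $|B|=\lfloor(1-c_0)k\rfloor$, $$\|W_{B*}\|\ge c_0\,\|D\|$$ holds for all unitarily invariant norms $\|\cdot\|$ on $\mathbb{R}^{p\times m}$, for all $p\ge k$ and $m\ge s$ (in particular, for all unitarily invariant norms on $\mathbb{R}^{k\times s}$). Here $W_{B*}$ denotes the $|B|\times s$ matrix formed by the rows of $W$ with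 indices in $B$. The matrix $W$ depends neither on $B$ nor on the norm. -/

import Mathlib

noncomputable section

section Frobenius

attribute [local instance] Matrix.frobeniusNormedAddCommGroup

/-- The Frobenius norm of a real matrix. -/
def frobNorm {k s : ℕ} (A : Matrix (Fin k) (Fin s) ℝ) : ℝ := ‖A‖

theorem frobNorm_eq_sqrt {k s : ℕ} (A : Matrix (Fin k) (Fin s) ℝ) :
    frobNorm A = Real.sqrt (∑ i, ∑ j, A i j ^ 2) := by
  simp [frobNorm, Matrix.frobenius_norm_def, Real.sqrt_eq_rpow]

end Frobenius

/-- A unitarily invariant norm on the space of real `p × m` matrices: a norm (a seminorm that is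
definite) with `‖U A V‖ = ‖A‖` for all orthogonal `U ∈ O(p)` and `V ∈ O(m)`. -/
structure IsUnitarilyInvariantNorm {p m : ℕ} (N : Seminorm ℝ (Matrix (Fin p) (Fin m) ℝ)) :
    Prop where
  eq_zero_of_map_eq_zero : ∀ A, N A = 0 → A = 0
  map_orthogonal_mul_mul : ∀ U ∈ Matrix.orthogonalGroup (Fin p) ℝ,
    ∀ V ∈ Matrix.orthogonalGroup (Fin m) ℝ, ∀ A, N (U * A * V) = N A

/-- The `p × m` matrix with the matrix `A` in its upper left corner and zeros elsewhere. -/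
def zeroPad {a b : ℕ} (p m : ℕ) (A : Matrix (Fin a) (Fin b) ℝ) : Matrix (Fin p) (Fin m) ℝ :=
  Matrix.of fun i j => if h : i.val < a ∧ j.val < b then A ⟨i.val, h.1⟩ ⟨j.val, h.2⟩ else 0

/-- The value of a norm `N` on `p × m` matrices at a matrix `A` of a smaller size `a × b`
(`a ≤ p`, `b ≤ m`), by the convention that `A` is padded with zeros. For `a = p`, `b = m` it is
`N A`. -/
def paddedNorm {a b p m : ℕ} (N : Seminorm ℝ (Matrix (Fin p) (Fin m) ℝ))
    (A : Matrix (Fin a) (Fin b) ℝ) : ℝ := N (zeroPad p m A)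

theorem paddedNorm_self {p m : ℕ} (N : Seminorm ℝ (Matrix (Fin p) (Fin m) ℝ))
    (A : Matrix (Fin p) (Fin m) ℝ) : paddedNorm N A = N A := by
  unfold paddedNorm
  congr 1
  ext i j
  simp [zeroPad]

/-- The `|B| × s` matrix formed by the rows of `W` with indices in `B`, in increasing order. -/
def rowSubmatrix {k s : ℕ} (W : Matrix (Fin k) (Fin s) ℝ) (B : Finset (Fin k)) :
    Matrix (Fin B.card) (Fin s) ℝ :=
  W.submatrix (B.orderEmbOfFin rfl) id

end

open Matrix

/-! Choose an orthogonal `U` such that `X = U * D` has pairwise orthogonal rows, and put `W = H * X`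
with `H` orthogonal and all entries of size at most `√(2/k)`. Up to a row permutation and padding,
`W_B` is `P * W` with `P` the projection onto `B`, so its norm is that of `G * X`, where `G = Hᵀ * P
* H`. Flatness of `H` keeps every diagonal entry of `G` at least `1/4`. Consider the seminorm `A ↦
‖A * X‖` on square matrices. Left sign flips preserve it by unitary invariance. So do right ones:
orthogonality of the rows turns a flip of a row of `X` into a reflection on the right. Hence
off-diagonal entries of `G` can be averaged away, and the remaining diagonal shrunk to `1/4` times
the identity, without increasing the seminorm. -/

/-- The diagonal matrix with a single entry `-1`, at position `i`, and all others `1`. -/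
noncomputable def signFlip {n : Type*} [DecidableEq n] (i : n) : Matrix n n ℝ :=
  Matrix.diagonal (Function.update 1 i (-1))

theorem signFlip_mem_orthogonalGroup {n : Type*} [Fintype n] [DecidableEq n] (i : n) :
    signFlip i ∈ Matrix.orthogonalGroup n ℝ := by
  rw [Matrix.mem_orthogonalGroup_iff, signFlip, Matrix.diagonal_transpose,
    Matrix.diagonal_mul_diagonal, ← Matrix.diagonal_one]
  congr 1
  ext j
  by_cases h : j = i
  · subst h; simp
  · simp [h]

/-! ### Seminorms invariant under sign flips -/

section Pinching

variable {n : Type*} [Fintype n] [DecidableEq n] (φ : Seminorm ℝ (Matrix n n ℝ))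

/-- A seminorm invariant under conjugation by sign flips decreases when off-diagonal entries are
deleted. -/
theorem seminorm_diagonal_diag_le
    (hφ : ∀ i A, φ (signFlip i * A * signFlip i) = φ A) (A : Matrix n n ℝ) :
    φ (Matrix.diagonal A.diag) ≤ φ A := by
  have key : ∀ S : Finset n,
      φ (Matrix.of fun i j => if i ≠ j ∧ (i ∈ S ∨ j ∈ S) then 0 else A i j) ≤ φ A := by
    intro S
    induction S using Finset.induction_on with
    | empty => exact le_of_eq (congrArg φ (by ext i j; simp))
    | insert a S ha ih =>
      set M : Matrix n n ℝ := Matrix.of fun i j => if i ≠ j ∧ (i ∈ S ∨ j ∈ S) then 0 else A i j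
        with hM
      -- Conjugation by the flip at `a` negates exactly the off-diagonal entries of row and column
      -- `a`, so averaging kills them.
      have hEq : (Matrix.of fun i j =>
          if i ≠ j ∧ (i ∈ insert a S ∨ j ∈ insert a S) then 0 else A i j)
          = (1 / 2 : ℝ) • (M + signFlip a * M * signFlip a) := by
        ext i j
        simp only [signFlip, hM, Matrix.of_apply, Matrix.smul_apply, Matrix.add_apply,
          Matrix.mul_diagonal, Matrix.diagonal_mul, Function.update_apply, Pi.one_apply,
          Finset.mem_insert, smul_eq_mul]
        by_cases hij : i = j
        · subst hij
          by_cases hi : i = a <;> simp [hi] <;> ring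
        · by_cases hi : i = a
          · have hj : j ≠ a := fun h => hij (hi.trans h.symm)
            have haj : a ≠ j := Ne.symm hj
            by_cases hS : a ∈ S ∨ j ∈ S <;> simp [hi, hj, haj, hS]
          · by_cases hj : j = a
            · simp [hi, hj]
            · simp only [hi, hj, false_or, if_false]
              ring
      rw [hEq, map_smul_eq_mul, Real.norm_of_nonneg (by norm_num)]
      have h := map_add_le_add φ M (signFlip a * M * signFlip a)
      rw [hφ] at h
      linarith
  refine le_trans (le_of_eq (congrArg φ ?_)) (key Finset.univ)
  ext i j
  by_cases hij : i = j
  · subst hij; simp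
  · simp [hij]

/-- A seminorm invariant under sign flips of the rows decreases when the rows are multiplied by
numbers in `[-1, 1]`. -/
theorem seminorm_diagonal_mul_le (hφ : ∀ i A, φ (signFlip i * A) = φ A) {t : n → ℝ}
    (ht : ∀ i, |t i| ≤ 1) (A : Matrix n n ℝ) : φ (Matrix.diagonal t * A) ≤ φ A := by
  have key : ∀ S : Finset n,
      φ (Matrix.diagonal (fun i => if i ∈ S then t i else 1) * A) ≤ φ A := by
    intro S
    induction S using Finset.induction_on with
    | empty => simp
    | insert a S ha ih =>
      set M := Matrix.diagonal (fun i => if i ∈ S then t i else 1) * A with hM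
      -- Since `|t a| ≤ 1`, this is a convex combination of `M` and its flip.
      have hEq : Matrix.diagonal (fun i => if i ∈ insert a S then t i else 1) * A
          = ((1 + t a) / 2) • M + ((1 - t a) / 2) • (signFlip a * M) := by
        ext i j
        simp only [signFlip, hM, Matrix.smul_apply, Matrix.add_apply, Matrix.diagonal_mul,
          Function.update_apply, Pi.one_apply, Finset.mem_insert, smul_eq_mul]
        by_cases hi : i = a
        · subst hi
          simp only [true_or, if_true, ha, if_false]
          ring
        · simp only [hi, false_or, if_false]
          ring
      obtain ⟨h1, h2⟩ := abs_le.1 (ht a)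
      rw [hEq]
      refine (map_add_le_add φ _ _).trans ?_
      rw [map_smul_eq_mul, map_smul_eq_mul, hφ, Real.norm_of_nonneg (by linarith),
        Real.norm_of_nonneg (by linarith)]
      linarith
  simpa using key Finset.univ

theorem le_seminorm_of_le_diag (hl : ∀ i A, φ (signFlip i * A) = φ A)
    (hr : ∀ i A, φ (A * signFlip i) = φ A) {c : ℝ} (hc : 0 < c) {G : Matrix n n ℝ}
    (hG : ∀ i, c ≤ G i i) : c * φ 1 ≤ φ G := by
  have h1 : φ (Matrix.diagonal G.diag) ≤ φ G :=
    seminorm_diagonal_diag_le φ (fun i A => by rw [hr, hl]) G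
  have h2 := seminorm_diagonal_mul_le φ hl (t := fun i => c / G i i)
    (fun i => by
      have := hc.trans_le (hG i)
      rw [abs_of_pos (by positivity), div_le_one this]
      exact hG i) (Matrix.diagonal G.diag)
  have h3 : Matrix.diagonal (fun i => c / G i i) * Matrix.diagonal G.diag
      = c • (1 : Matrix n n ℝ) := by
    rw [Matrix.diagonal_mul_diagonal, Matrix.smul_one_eq_diagonal]
    congr 1
    ext i
    simp [(hc.trans_le (hG i)).ne']
  rw [h3, map_smul_eq_mul, Real.norm_of_nonneg hc.le] at h2
  exact h2.trans h1

end Pinching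

/-- Reversing one row of a matrix with pairwise orthogonal rows is a multiplication by an orthogonal
matrix (a reflection) from the right. -/
theorem exists_orthogonal_mul_eq_signFlip_mul {m n : Type*} [Fintype m] [DecidableEq m] [Fintype n]
    [DecidableEq n] {X : Matrix m n ℝ} {lam : m → ℝ} (hX : X * Xᵀ = Matrix.diagonal lam) (i : m) :
    ∃ V ∈ Matrix.orthogonalGroup n ℝ, signFlip i * X = X * V := by
  have hdot : ∀ a b, X a ⬝ᵥ X b = if a = b then lam a else 0 := fun a b => by
    have := congrFun (congrFun hX a) b
    rwa [Matrix.mul_apply', Matrix.diagonal_apply] at this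
  by_cases h0 : lam i = 0
  · refine ⟨1, one_mem _, ?_⟩
    have hi : X i = 0 := by
      have := hdot i i
      rwa [if_pos rfl, h0, dotProduct_self_eq_zero] at this
    ext a b
    rw [signFlip, Matrix.diagonal_mul, Matrix.mul_one, Function.update_apply]
    split_ifs with h
    · simp [h, hi]
    · simp
  · have hmul : ∀ a b, (X * vecMulVec (X i) (X i)) a b = if a = i then lam i * X i b else 0 := by
      intro a b
      rw [Matrix.mul_vecMulVec, vecMulVec_apply]
      change (X a ⬝ᵥ X i) * _ = _
      rw [hdot]
      split_ifs with h
      · rw [h]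
      · simp
    -- The Householder reflection in the hyperplane orthogonal to row `i`; it fixes all other rows.
    refine ⟨1 - (2 / lam i) • vecMulVec (X i) (X i), ?_, ?_⟩
    · rw [Matrix.mem_orthogonalGroup_iff]
      have hsq : vecMulVec (X i) (X i) * vecMulVec (X i) (X i)
          = lam i • vecMulVec (X i) (X i) := by
        rw [Matrix.vecMulVec_mul_vecMulVec, hdot, if_pos rfl]
        ext a b
        simp only [vecMulVec_apply, Matrix.smul_apply, Pi.smul_apply, smul_eq_mul]
        ring
      rw [Matrix.transpose_sub, Matrix.transpose_one, Matrix.transpose_smul,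
        Matrix.transpose_vecMulVec, Matrix.sub_mul, Matrix.mul_sub, Matrix.mul_sub, Matrix.one_mul,
        Matrix.mul_one, Matrix.one_mul, Matrix.smul_mul, Matrix.mul_smul, hsq]
      ext a b
      simp only [Matrix.sub_apply, Matrix.smul_apply, smul_eq_mul]
      field_simp
      ring
    · ext a b
      rw [Matrix.mul_sub, Matrix.mul_one, Matrix.mul_smul, Matrix.sub_apply, Matrix.smul_apply,
        hmul, signFlip, Matrix.diagonal_mul, Function.update_apply]
      split_ifs with h
      · subst h
        rw [smul_eq_mul]
        field_simp
        ring
      · simp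

/-! ### A flat orthogonal matrix in every dimension -/

section Hartley

theorem sum_exp_mul_eq {k : ℕ} (hk : k ≠ 0) (l : ℤ) :
    ∑ j : Fin k, Complex.exp (((2 * Real.pi / k * l * (j : ℕ) : ℝ) : ℂ) * Complex.I)
      = if (k : ℤ) ∣ l then (k : ℂ) else 0 := by
  have hζ := Complex.isPrimitiveRoot_exp k hk
  set ζ := Complex.exp (2 * Real.pi * Complex.I / k) with hζd
  have hterm : ∀ j : ℕ, Complex.exp (((2 * Real.pi / k * l * (j : ℕ) : ℝ) : ℂ) * Complex.I)
      = (ζ ^ l) ^ j := by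
    intro j
    rw [hζd, ← Complex.exp_int_mul, ← Complex.exp_nat_mul]
    congr 1
    push_cast
    ring
  simp only [hterm]
  rw [Fin.sum_univ_eq_sum_range (fun j => (ζ ^ l) ^ j) k]
  split_ifs with h
  · rw [(hζ.zpow_eq_one_iff_dvd l).2 h]
    simp
  · have h1 : ζ ^ l - 1 ≠ 0 := fun h' => h ((hζ.zpow_eq_one_iff_dvd l).1 (sub_eq_zero.1 h'))
    have h2 := mul_geom_sum (ζ ^ l) k
    have h3 : (ζ ^ l) ^ k = 1 := by
      rw [← zpow_natCast, ← _root_.zpow_mul, hζ.zpow_eq_one_iff_dvd]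
      exact dvd_mul_left _ _
    rw [h3, sub_self] at h2
    exact (mul_eq_zero.1 h2).resolve_left h1

theorem sum_cos_mul_eq {k : ℕ} (hk : k ≠ 0) (l : ℤ) :
    ∑ j : Fin k, Real.cos (2 * Real.pi / k * l * (j : ℕ)) = if (k : ℤ) ∣ l then (k : ℝ) else 0 := by
  have h := congrArg Complex.re (sum_exp_mul_eq hk l)
  simp only [Complex.re_sum, Complex.exp_ofReal_mul_I_re] at h
  rw [h]
  split_ifs <;> simp

theorem sum_sin_mul_eq {k : ℕ} (hk : k ≠ 0) (l : ℤ) :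
    ∑ j : Fin k, Real.sin (2 * Real.pi / k * l * (j : ℕ)) = 0 := by
  have h := congrArg Complex.im (sum_exp_mul_eq hk l)
  simp only [Complex.im_sum, Complex.exp_ofReal_mul_I_im] at h
  rw [h]
  split_ifs <;> simp

/-- The matrix of the discrete Hartley transform. -/
noncomputable def hartleyMatrix (k : ℕ) : Matrix (Fin k) (Fin k) ℝ :=
  Matrix.of fun i j =>
    (Real.cos (2 * Real.pi / k * (i : ℕ) * (j : ℕ)) + Real.sin (2 * Real.pi / k * (i : ℕ) * (j : ℕ)))
      / Real.sqrt k

theorem hartleyMatrix_mem_orthogonalGroup {k : ℕ} (hk : k ≠ 0) :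
    hartleyMatrix k ∈ Matrix.orthogonalGroup (Fin k) ℝ := by
  have hk' : (0 : ℝ) < k := by positivity
  rw [Matrix.mem_orthogonalGroup_iff]
  ext i l
  rw [Matrix.mul_apply]
  -- Uses `(cos x + sin x)(cos y + sin y) = cos (x - y) + sin (x + y)`; the sine sums vanish.
  have hterm : ∀ j : Fin k, hartleyMatrix k i j * (hartleyMatrix k)ᵀ j l
      = (Real.cos (2 * Real.pi / k * ((i : ℤ) - (l : ℤ) : ℤ) * (j : ℕ))
        + Real.sin (2 * Real.pi / k * ((i : ℤ) + (l : ℤ) : ℤ) * (j : ℕ))) / k := by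
    intro j
    have e1 : 2 * Real.pi / k * (((i : ℤ) - (l : ℤ) : ℤ) : ℝ) * (j : ℕ)
      = 2 * Real.pi / k * (i : ℕ) * (j : ℕ) - 2 * Real.pi / k * (l : ℕ) * (j : ℕ) := by
      push_cast; ring
    have e2 : 2 * Real.pi / k * (((i : ℤ) + (l : ℤ) : ℤ) : ℝ) * (j : ℕ)
      = 2 * Real.pi / k * (i : ℕ) * (j : ℕ) + 2 * Real.pi / k * (l : ℕ) * (j : ℕ) := by
      push_cast; ring
    rw [e1, e2, Real.cos_sub, Real.sin_add, hartleyMatrix, Matrix.transpose_apply, Matrix.of_apply,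
      Matrix.of_apply, div_mul_div_comm, Real.mul_self_sqrt hk'.le]
    ring
  rw [Finset.sum_congr rfl fun j _ => hterm j, ← Finset.sum_div, Finset.sum_add_distrib,
    sum_cos_mul_eq hk, sum_sin_mul_eq hk, add_zero, Matrix.one_apply]
  have hiff : (k : ℤ) ∣ (i : ℤ) - (l : ℤ) ↔ i = l := by
    constructor
    · intro h
      have := Int.eq_zero_of_abs_lt_dvd h (by rw [abs_lt]; omega)
      exact Fin.ext (by omega)
    · rintro rfl; simp
  simp only [hiff]
  split_ifs
  · exact div_self hk'.ne'
  · simp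

theorem hartleyMatrix_sq_le (k : ℕ) (i j : Fin k) : hartleyMatrix k i j ^ 2 ≤ 2 / k := by
  rw [hartleyMatrix, Matrix.of_apply, div_pow, Real.sq_sqrt (Nat.cast_nonneg k)]
  gcongr
  generalize 2 * Real.pi / k * (i : ℕ) * (j : ℕ) = x
  nlinarith [Real.sin_sq_add_cos_sq x, sq_nonneg (Real.cos x - Real.sin x)]

end Hartley

/-- The diagonal matrix of the coordinate projection onto `B`. -/
noncomputable def coordProj {n : Type*} [DecidableEq n] (B : Finset n) : Matrix n n ℝ :=
  Matrix.diagonal fun i => if i ∈ B then 1 else 0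

/-- If the entries of an orthogonal matrix are bounded by `√ε`, then each of its columns restricted
to `B` has squared norm at least `1 - ε |Bᶜ|`. -/
theorem le_transpose_mul_coordProj_mul_apply {n : Type*} [Fintype n] [DecidableEq n]
    {H : Matrix n n ℝ} (hH : H ∈ Matrix.orthogonalGroup n ℝ) {ε : ℝ} (hε : ∀ i j, H i j ^ 2 ≤ ε)
    (B : Finset n) (j : n) : 1 - Bᶜ.card * ε ≤ (Hᵀ * coordProj B * H) j j := by
  have h1 : ∑ i, H i j ^ 2 = 1 := by
    have := congrFun (congrFun ((Matrix.mem_orthogonalGroup_iff' _ _).1 hH) j) j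
    rw [Matrix.mul_apply, Matrix.one_apply_eq] at this
    rw [← this]
    exact Finset.sum_congr rfl fun i _ => by rw [Matrix.transpose_apply, sq]
  have h2 : (Hᵀ * coordProj B * H) j j = ∑ i ∈ B, H i j ^ 2 := by
    rw [Matrix.mul_apply, ← Finset.sum_subset (Finset.subset_univ B)]
    · refine Finset.sum_congr rfl fun i hi => ?_
      simp [coordProj, Matrix.mul_diagonal, hi, sq]
    · intro i _ hi
      simp [coordProj, Matrix.mul_diagonal, hi]
  have h3 : ∑ i ∈ Bᶜ, H i j ^ 2 ≤ Bᶜ.card * ε := by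
    rw [← nsmul_eq_mul]
    exact Finset.sum_le_card_nsmul _ _ _ fun i _ => hε i j
  rw [h2]
  linarith [Finset.sum_add_sum_compl B fun i => H i j ^ 2]

/-! ### Zero padding and unitary invariance -/

section Padding

theorem fromBlocks_one_mem_orthogonalGroup {m n : Type*} [Fintype m] [DecidableEq m] [Fintype n]
    [DecidableEq n] {U : Matrix m m ℝ} (hU : U ∈ Matrix.orthogonalGroup m ℝ) :
    Matrix.fromBlocks U 0 0 (1 : Matrix n n ℝ) ∈ Matrix.orthogonalGroup (m ⊕ n) ℝ := by
  rw [Matrix.mem_orthogonalGroup_iff] at hU ⊢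
  simp [Matrix.fromBlocks_transpose, Matrix.fromBlocks_multiply, hU]

theorem reindex_mem_orthogonalGroup {m n : Type*} [Fintype m] [DecidableEq m] [Fintype n]
    [DecidableEq n] (e : m ≃ n) {U : Matrix m m ℝ} (hU : U ∈ Matrix.orthogonalGroup m ℝ) :
    U.submatrix e.symm e.symm ∈ Matrix.orthogonalGroup n ℝ := by
  rw [Matrix.mem_orthogonalGroup_iff] at hU ⊢
  rw [Matrix.transpose_submatrix, Matrix.submatrix_mul_equiv, hU, Matrix.submatrix_one_equiv]

theorem zeroPad_add_add {k s q r : ℕ} (A : Matrix (Fin k) (Fin s) ℝ) :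
    zeroPad (k + q) (s + r) A
      = (Matrix.fromBlocks A 0 0 (0 : Matrix (Fin q) (Fin r) ℝ)).submatrix finSumFinEquiv.symm
        finSumFinEquiv.symm := by
  ext i j
  refine Fin.addCases (fun i => ?_) (fun i => ?_) i <;>
    refine Fin.addCases (fun j => ?_) (fun j => ?_) j <;> simp [zeroPad]

theorem exists_orthogonal_mul_zeroPad_mul {k s p m : ℕ} (hp : k ≤ p) (hm : s ≤ m)
    {U : Matrix (Fin k) (Fin k) ℝ} (hU : U ∈ Matrix.orthogonalGroup (Fin k) ℝ)
    {V : Matrix (Fin s) (Fin s) ℝ} (hV : V ∈ Matrix.orthogonalGroup (Fin s) ℝ) :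
    ∃ U' ∈ Matrix.orthogonalGroup (Fin p) ℝ, ∃ V' ∈ Matrix.orthogonalGroup (Fin m) ℝ,
      ∀ A : Matrix (Fin k) (Fin s) ℝ, U' * zeroPad p m A * V' = zeroPad p m (U * A * V) := by
  obtain ⟨q, rfl⟩ := Nat.exists_eq_add_of_le hp
  obtain ⟨r, rfl⟩ := Nat.exists_eq_add_of_le hm
  refine ⟨_, reindex_mem_orthogonalGroup finSumFinEquiv
    (fromBlocks_one_mem_orthogonalGroup (n := Fin q) hU), _,
    reindex_mem_orthogonalGroup finSumFinEquiv
    (fromBlocks_one_mem_orthogonalGroup (n := Fin r) hV), fun A => ?_⟩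
  simp [zeroPad_add_add, Matrix.submatrix_mul_equiv, Matrix.fromBlocks_multiply]

/-- Zero padding as a linear map. -/
def zeroPadLinearMap (k s p m : ℕ) :
    Matrix (Fin k) (Fin s) ℝ →ₗ[ℝ] Matrix (Fin p) (Fin m) ℝ where
  toFun := zeroPad p m
  map_add' A B := by
    ext i j
    by_cases h : i.val < k ∧ j.val < s <;> simp [zeroPad, h]
  map_smul' c A := by
    ext i j
    by_cases h : i.val < k ∧ j.val < s <;> simp [zeroPad, h]

theorem paddedNorm_mul_mul {k s p m : ℕ} (hp : k ≤ p) (hm : s ≤ m)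
    {N : Seminorm ℝ (Matrix (Fin p) (Fin m) ℝ)} (hN : IsUnitarilyInvariantNorm N)
    {U : Matrix (Fin k) (Fin k) ℝ} (hU : U ∈ Matrix.orthogonalGroup (Fin k) ℝ)
    {V : Matrix (Fin s) (Fin s) ℝ} (hV : V ∈ Matrix.orthogonalGroup (Fin s) ℝ)
    (A : Matrix (Fin k) (Fin s) ℝ) : paddedNorm N (U * A * V) = paddedNorm N A := by
  obtain ⟨U', hU', V', hV', h⟩ := exists_orthogonal_mul_zeroPad_mul hp hm hU hV
  rw [paddedNorm, ← h, hN.map_orthogonal_mul_mul U' hU' V' hV', paddedNorm]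

theorem paddedNorm_mul {k s p m : ℕ} (hp : k ≤ p) (hm : s ≤ m)
    {N : Seminorm ℝ (Matrix (Fin p) (Fin m) ℝ)} (hN : IsUnitarilyInvariantNorm N)
    {U : Matrix (Fin k) (Fin k) ℝ} (hU : U ∈ Matrix.orthogonalGroup (Fin k) ℝ)
    (A : Matrix (Fin k) (Fin s) ℝ) : paddedNorm N (U * A) = paddedNorm N A := by
  simpa using paddedNorm_mul_mul hp hm hN hU (one_mem _) A

theorem paddedNorm_zeroPad {a k s p m : ℕ} (ha : a ≤ k) (N : Seminorm ℝ (Matrix (Fin p) (Fin m) ℝ))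
    (A : Matrix (Fin a) (Fin s) ℝ) : paddedNorm N (zeroPad k s A) = paddedNorm N A := by
  rw [paddedNorm, paddedNorm]
  congr 1
  ext i j
  by_cases h : i.val < a
  · have := h.trans_le ha
    by_cases hj : j.val < s <;> simp [zeroPad, *]
  · by_cases hj : j.val < s <;> simp [zeroPad, *]

/-- The rows of `W` in `B`, padded with zeros, are a row permutation of the projection of `W`. -/
theorem zeroPad_rowSubmatrix {k s : ℕ} (W : Matrix (Fin k) (Fin s) ℝ) (B : Finset (Fin k)) :
    ∃ σ : Equiv.Perm (Fin k),
      zeroPad k s (rowSubmatrix W B) = (coordProj B * W).submatrix σ id := by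
  obtain ⟨q, hq⟩ : ∃ q, Bᶜ.card = q := ⟨_, rfl⟩
  have hk : B.card + q = k := by
    rw [← hq, Finset.card_add_card_compl, Fintype.card_fin]
  refine ⟨((finCongr hk).symm.trans finSumFinEquiv.symm).trans (finSumEquivOfFinset rfl hq), ?_⟩
  ext i j
  obtain ⟨i, rfl⟩ := (finCongr hk).surjective i
  refine Fin.addCases (fun i => ?_) (fun i => ?_) i
  · simp [zeroPad, rowSubmatrix, coordProj, Matrix.diagonal_mul]
  · have : (finSumEquivOfFinset rfl hq) (Sum.inr i) ∉ B := by
      rw [finSumEquivOfFinset_inr, ← Finset.mem_compl]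
      exact Finset.orderEmbOfFin_mem _ _ _
    rw [finSumEquivOfFinset_inr] at this
    simp [this, zeroPad, coordProj, Matrix.diagonal_mul]

theorem permMatrix_mem_orthogonalGroup {n : Type*} [Fintype n] [DecidableEq n]
    (σ : Equiv.Perm n) : σ.permMatrix ℝ ∈ Matrix.orthogonalGroup n ℝ := by
  rw [Matrix.mem_orthogonalGroup_iff, Matrix.transpose_permMatrix, ← Matrix.permMatrix_mul]
  simp

theorem paddedNorm_rowSubmatrix {k s p m : ℕ} (hp : k ≤ p) (hm : s ≤ m)
    {N : Seminorm ℝ (Matrix (Fin p) (Fin m) ℝ)} (hN : IsUnitarilyInvariantNorm N)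
    (W : Matrix (Fin k) (Fin s) ℝ) (B : Finset (Fin k)) :
    paddedNorm N (rowSubmatrix W B) = paddedNorm N (coordProj B * W) := by
  obtain ⟨σ, hσ⟩ := zeroPad_rowSubmatrix W B
  rw [← paddedNorm_zeroPad (card_finset_fin_le B), hσ, ← PEquiv.toMatrix_toPEquiv_mul]
  exact paddedNorm_mul hp hm hN (permMatrix_mem_orthogonalGroup σ) _

end Padding

theorem frobNorm_orthogonal_mul {k s : ℕ} {U : Matrix (Fin k) (Fin k) ℝ}
    (hU : U ∈ Matrix.orthogonalGroup (Fin k) ℝ) (A : Matrix (Fin k) (Fin s) ℝ) :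
    frobNorm (U * A) = frobNorm A := by
  have h : ∀ M : Matrix (Fin k) (Fin s) ℝ, ∑ i, ∑ j, M i j ^ 2 = (Mᵀ * M).trace := by
    intro M
    rw [Finset.sum_comm]
    simp only [Matrix.trace, Matrix.diag, Matrix.mul_apply, Matrix.transpose_apply, sq]
  rw [frobNorm_eq_sqrt, frobNorm_eq_sqrt, h, h, Matrix.transpose_mul, Matrix.mul_assoc,
    ← Matrix.mul_assoc Uᵀ, (Matrix.mem_orthogonalGroup_iff' _ _).1 hU, Matrix.one_mul]

/-- Every real matrix has pairwise orthogonal rows after an orthogonal change of basis. -/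
theorem exists_orthogonal_mul_orthogonal_rows {m n : Type*} [Fintype m] [DecidableEq m] [Fintype n]
    (D : Matrix m n ℝ) : ∃ U ∈ Matrix.orthogonalGroup m ℝ, ∃ lam : m → ℝ,
      (U * D) * (U * D)ᵀ = Matrix.diagonal lam := by
  have hA : (D * Dᵀ).IsHermitian := by
    simpa using Matrix.isHermitian_mul_conjTranspose_self D
  have h := hA.conjStarAlgAut_star_eigenvectorUnitary
  refine ⟨star (hA.eigenvectorUnitary : Matrix m m ℝ), (star hA.eigenvectorUnitary).2,
    hA.eigenvalues, ?_⟩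
  rw [Unitary.conjStarAlgAut_apply] at h
  rw [Matrix.transpose_mul, Matrix.mul_assoc, ← Matrix.mul_assoc D, ← Matrix.mul_assoc]
  simpa [Matrix.star_eq_conjTranspose] using h

/-- Pinching applied to the seminorm `A ↦ ‖A * X‖`; orthogonality of the rows of `X` supplies its
invariance under right flips. -/
theorem mul_paddedNorm_le_of_le_diag {k s p m : ℕ} (hp : k ≤ p) (hm : s ≤ m)
    {N : Seminorm ℝ (Matrix (Fin p) (Fin m) ℝ)} (hN : IsUnitarilyInvariantNorm N)
    {X : Matrix (Fin k) (Fin s) ℝ} {lam : Fin k → ℝ} (hX : X * Xᵀ = Matrix.diagonal lam)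
    {c : ℝ} (hc : 0 < c) {G : Matrix (Fin k) (Fin k) ℝ} (hG : ∀ i, c ≤ G i i) :
    c * paddedNorm N X ≤ paddedNorm N (G * X) := by
  let φ : Seminorm ℝ (Matrix (Fin k) (Fin k) ℝ) :=
    N.comp ((zeroPadLinearMap k s p m).comp (mulRightLinearMap (Fin k) ℝ X))
  have hφ : ∀ A, φ A = paddedNorm N (A * X) := fun _ => rfl
  have h := le_seminorm_of_le_diag φ (fun i A => ?_) (fun i A => ?_) hc hG
  · rwa [hφ, hφ, Matrix.one_mul] at h
  · rw [hφ, hφ, Matrix.mul_assoc]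
    exact paddedNorm_mul hp hm hN (signFlip_mem_orthogonalGroup i) _
  · obtain ⟨V, hV, hVX⟩ := exists_orthogonal_mul_eq_signFlip_mul hX i
    rw [hφ, hφ, Matrix.mul_assoc, hVX, ← Matrix.mul_assoc]
    simpa using paddedNorm_mul_mul hp hm hN (one_mem _) hV (A * X)

theorem lemma4p1 :
    ∃ c₀ : ℝ, 0 < c₀ ∧ c₀ < 1 ∧
      ∀ (k s : ℕ), 50 ≤ k → 1 ≤ s →
        ∀ D : Matrix (Fin k) (Fin s) ℝ, ∃ W : Matrix (Fin k) (Fin s) ℝ,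
          frobNorm W ≤ frobNorm D ∧
          ∀ B : Finset (Fin k), B.card = ⌊(1 - c₀) * (k : ℝ)⌋₊ →
            ∀ (p m : ℕ), k ≤ p → s ≤ m →
              ∀ N : Seminorm ℝ (Matrix (Fin p) (Fin m) ℝ), IsUnitarilyInvariantNorm N →
                c₀ * paddedNorm N D ≤ paddedNorm N (rowSubmatrix W B) := by
  refine ⟨1 / 4, by norm_num, by norm_num, fun k s hk _ D => ?_⟩
  obtain ⟨U, hU, lam, hX⟩ := exists_orthogonal_mul_orthogonal_rows D
  have hH := hartleyMatrix_mem_orthogonalGroup (k := k) (by omega)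
  set H := hartleyMatrix k
  refine ⟨H * (U * D), ?_, fun B hB p m hp hm N hN => ?_⟩
  · rw [frobNorm_orthogonal_mul hH, frobNorm_orthogonal_mul hU]
  have hkR : (50 : ℝ) ≤ k := by exact_mod_cast hk
  -- As `|Bᶜ| < k/4 + 1`, the left side is below `1/2 + 2/k`; the slack absorbs the floor.
  have hcard : (Bᶜ.card : ℝ) * (2 / k) ≤ 3 / 4 := by
    have h1 : (B.card : ℝ) + Bᶜ.card = k := by
      exact_mod_cast (Finset.card_add_card_compl B).trans (Fintype.card_fin k)
    have h2 := Nat.lt_floor_add_one ((1 - 1 / 4) * (k : ℝ))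
    rw [← hB] at h2
    rw [mul_div_assoc', div_le_iff₀ (by linarith)]
    linarith
  have hHt : Hᵀ ∈ Matrix.orthogonalGroup (Fin k) ℝ := by
    rw [Matrix.mem_orthogonalGroup_iff, Matrix.transpose_transpose]
    exact (Matrix.mem_orthogonalGroup_iff' _ _).1 hH
  -- Multiplying by `Hᵀ` on the left is free and produces `G * X`.
  rw [paddedNorm_rowSubmatrix hp hm hN, ← paddedNorm_mul hp hm hN hHt (coordProj B * _), ← paddedNorm_mul hp hm hN hU D]
  rw [← Matrix.mul_assoc (coordProj B), ← Matrix.mul_assoc Hᵀ, ← Matrix.mul_assoc Hᵀ]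
  refine mul_paddedNorm_le_of_le_diag hp hm hN hX (by norm_num) fun j => ?_
  linarith [le_transpose_mul_coordProj_mul_apply hH (hartleyMatrix_sq_le k) B j]
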